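/- Let $\mathbb{X}$ be a (real or complex) Banach space with an unconditional basis $(x_j)_{j=1}^\infty$, let $(x_j^*)_{j=1}^\infty$ in $\mathbb{X}^*$ be its biorthogonal functionals, and let $\mathbb{Y}=[x_j^*\colon j\in\mathbb{N}]$ be their closed linear span in $\mathbb{X}^*$. Here $[\,\cdot\,]$ denotes the closed linear span, and $\operatorname{supp}(f)=\{j\in\mathbb{N}\colon x_j^*(f)\neq 0\}$ for $f\in\mathbb{X}$. Suppose that there are a constant $C$ and a non-decreasing sequence $(j_n)_{n=1}^\infty$ in $\mathbb{N}$ such that \[ \Bigl\Vert \sum_{n=1}^\infty f_n\Bigr\Vert \le C \Bigl\Vert \sum_{n=1}^\infty g_n\Bigr\Vert \] whenever $(f_n)_{n=1}^\infty$ and $(g_n)_{n=1}^\infty$ in $\mathbb{X}$ and a strictly increasing sequence $(k_n)_{n=1}^\infty$ in $\mathbb{N}$ are such that both series converge unconditionally and, for all $n\in\mathbb{N}$, $\Vert f_n\Vert\le\Vert g_n\Vert$, $\operatorname{supp}(f_n)\cup\operatorname{supp}(g_n)\subseteq[k_n,k_{n+1}-1]$ and $j_n\le k_n$. Given a set $\mathcal{U}$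 of infinite-dimensional Banach spaces, a Banach space $\mathbb{E}$ is called $\mathcal{U}$-subprojective if every infinite-dimensional closed subspace $\mathbb{V}$ of $\mathbb{E}$ contains an (infinite-dimensional) subspace that is complemented in $\mathbb{E}$, i.e. the range of a bounded linear projection on $\mathbb{E}$, and is isomorphic to a member of $\mathcal{U}$. Then $\mathbb{X}$ is $\mathcal{U}$-subprojective and $\mathbb{Y}$ is $\mathcal{U}^*$-subprojective, where \begin{align*} \mathcal{U}&=\{[x_{k_n}\colon n\in\mathbb{N}]\colon\ j_n\le k_n<k_{n+1}\ \text{for all } n\in\mathbb{N}\},\\ \mathcal{U}^*&=\{[x_{k_n}^*\colon n\in\mathbb{N}]\colon\ j_n\le k_n<k_{n+1}\ \text{for all } n\in\mathbb{N}\}. \end{align*} -/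

import Mathlib

namespace UncondBasis

section

variable {𝕜 : Type*} [RCLike 𝕜]
variable {X : Type*} [NormedAddCommGroup X] [NormedSpace 𝕜 X]

/-- The closed linear span `[v n : n ∈ ℕ]` of a sequence. -/
def closedSpan (v : ℕ → X) : Submodule 𝕜 X :=
  (Submodule.span 𝕜 (Set.range v)).topologicalClosure

/-- The support of a vector with respect to a basis. -/
def supp (b : UnconditionalSchauderBasis ℕ 𝕜 X) (f : X) : Set ℕ :=
  {i | b.coord i f ≠ 0}

/-- `‖∑ f n‖ ≤ C * ‖∑ g n‖` for all convergent series of vectors `f n`, `g n` with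
`‖f n‖ ≤ ‖g n‖` that are supported on consecutive intervals `[k n, k (n + 1) - 1]`,
where `k` is increasing and `j n ≤ k n`. -/
def BlockDomination (b : UnconditionalSchauderBasis ℕ 𝕜 X) (C : ℝ) (j : ℕ → ℕ) : Prop :=
  ∀ (k : ℕ → ℕ) (f g : ℕ → X) (F G : X), StrictMono k → (∀ n, j n ≤ k n) →
    (∀ n, ‖f n‖ ≤ ‖g n‖) → (∀ n, supp b (f n) ∪ supp b (g n) ⊆ Set.Ico (k n) (k (n + 1))) →
    HasSum f F → HasSum g G → ‖F‖ ≤ C * ‖G‖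

/-- The spaces `[v (k n) : n ∈ ℕ]`, where `k` is increasing and `j n ≤ k n` for all `n`. -/
def subbasisSpans (𝕜 : Type*) [RCLike 𝕜] {X : Type*} [NormedAddCommGroup X] [NormedSpace 𝕜 X]
    (v : ℕ → X) (j : ℕ → ℕ) : Set (Submodule 𝕜 X) :=
  {W | ∃ k : ℕ → ℕ, StrictMono k ∧ (∀ n, j n ≤ k n) ∧ W = closedSpan (fun n => v (k n))}

/-- `E` is `𝒰`-subprojective: every infinite-dimensional closed subspace `V` of `E` contains an
infinite-dimensional subspace `U` that is complemented in `E` and isomorphic to a member of `𝒰`.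
The members of `𝒰` are given as subspaces of a space `F`, which may differ from `E`. -/
def IsSubprojectiveFor (𝕜 : Type*) [RCLike 𝕜] (E : Type*) [NormedAddCommGroup E]
    [NormedSpace 𝕜 E] {F : Type*} [NormedAddCommGroup F] [NormedSpace 𝕜 F]
    (𝒰 : Set (Submodule 𝕜 F)) : Prop :=
  ∀ V : Submodule 𝕜 E, IsClosed (V : Set E) → ¬ FiniteDimensional 𝕜 V →
    ∃ U : Submodule 𝕜 E, U ≤ V ∧ ¬ FiniteDimensional 𝕜 U ∧ U.ClosedComplemented ∧
      ∃ W ∈ 𝒰, Nonempty (U ≃L[𝕜] W)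

end

end UncondBasis

/-! Domination makes every normalized block sequence u_n with blocks starting at k_n ≥ j_n behave
like the normalized vectors b(k_n): u_n and b(k_n) occupy the same interval, so the hypothesis
applies in both directions. One direction bounds S : b(k_n) ↦ ‖b(k_n)‖ u_n. The other, with norming
functionals of the u_n, bounds R, which inverts S on W = [b(k_n)]; hence [u_n] is a complemented
copy of W. A gliding hump places such a sequence, up to a summable error, inside any
infinite-dimensional V. Adding that error to S gives an operator from W into V that R still inverts
up to a Neumann series. For the dual statement it suffices that the coordinate functionals form an
unconditional basis of their closed span which inherits domination (`BlockDomination.dualBasis`);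
the first half then applies to them. -/

namespace UncondBasis

open Filter Topology

/-! ### Complemented copies and small perturbations -/

section ComplementedCopy

variable {𝕜 : Type*} [RCLike 𝕜]
variable {E : Type*} [NormedAddCommGroup E] [NormedSpace 𝕜 E]
variable {W : Type*} [NormedAddCommGroup W] [NormedSpace 𝕜 W]

/-- A continuous linear map with a continuous left inverse is an isomorphism onto a complemented
subspace. -/
theorem closedComplemented_range_of_leftInverse (S : W →L[𝕜] E) (R : E →L[𝕜] W)
    (h : ∀ w, R (S w) = w) :
    S.toLinearMap.range.ClosedComplemented ∧ Nonempty (S.toLinearMap.range ≃L[𝕜] W) := by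
  have hmem : ∀ x, S x ∈ S.toLinearMap.range := fun x => ⟨x, rfl⟩
  refine ⟨⟨(S.comp R).codRestrict _ fun x => hmem _, ?_⟩, ⟨?_⟩⟩
  · rintro ⟨_, w, rfl⟩
    exact Subtype.ext (congrArg S (h w))
  · refine ContinuousLinearEquiv.equivOfInverse (R.comp S.toLinearMap.range.subtypeL)
      (S.codRestrict _ hmem) ?_ ?_
    · rintro ⟨_, w, rfl⟩
      exact Subtype.ext (congrArg S (h w))
    · exact h

/-- If `S` is close to a map with left inverse `R`, then its range is complemented and isomorphic
to the domain. -/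
theorem exists_complemented_copy [CompleteSpace W] (hW : ¬ FiniteDimensional 𝕜 W)
    (S₀ S : W →L[𝕜] E) (R : E →L[𝕜] W) (h : ∀ w, R (S₀ w) = w)
    (hS : ‖R.comp (S₀ - S)‖ < 1) (V : Submodule 𝕜 E) (hV : ∀ w, S w ∈ V) :
    ∃ U : Submodule 𝕜 E, U ≤ V ∧ ¬ FiniteDimensional 𝕜 U ∧ U.ClosedComplemented ∧
      Nonempty (U ≃L[𝕜] W) := by
  -- Since R S₀ = 1, this unit is R S; its inverse composed with R is a left inverse of S.
  let u : (W →L[𝕜] W)ˣ := Units.oneSub (R.comp (S₀ - S)) hS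
  have hu : ∀ w, (u : W →L[𝕜] W) w = R (S w) := by
    intro w
    simp [u, Units.val_oneSub, h]
  have hinv : ∀ w, ((↑u⁻¹ : W →L[𝕜] W).comp R) (S w) = w := by
    intro w
    rw [ContinuousLinearMap.comp_apply, ← hu, ← mul_apply_eq_comp, Units.inv_mul]
    rfl
  obtain ⟨h1, ⟨e⟩⟩ := closedComplemented_range_of_leftInverse S _ hinv
  refine ⟨S.toLinearMap.range, ?_, ?_, h1, ⟨e⟩⟩
  · rintro _ ⟨w, rfl⟩
    exact hV w
  · intro hfin
    exact hW (LinearEquiv.finiteDimensional e.toLinearEquiv)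

end ComplementedCopy

/-! ### Coordinate projections, block operators and the gliding hump -/

section Basis

variable {𝕜 : Type*} [RCLike 𝕜]
variable {X : Type*} [NormedAddCommGroup X] [NormedSpace 𝕜 X]

theorem coord_proj (b : UnconditionalSchauderBasis ℕ 𝕜 X) (A : Finset ℕ) (x : X) (i : ℕ) :
    b.coord i (b.proj A x) = if i ∈ A then b.coord i x else 0 := by
  simp [b.ortho, Pi.single_apply]

theorem supp_proj_subset (b : UnconditionalSchauderBasis ℕ 𝕜 X) (A : Finset ℕ) (x : X) :
    supp b (b.proj A x) ⊆ A := by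
  intro i hi
  by_contra h
  exact hi (by rw [coord_proj, if_neg (by simpa using h)])

theorem proj_eq_self_of_supp_subset (b : UnconditionalSchauderBasis ℕ 𝕜 X) {A : Finset ℕ} {x : X}
    (h : supp b x ⊆ A) : b.proj A x = x := by
  rw [GeneralSchauderBasis.proj_apply]
  refine (hasSum_sum_of_ne_finset_zero fun i hi => ?_).unique (b.expansion x)
  have : b.coord i x = 0 := by
    by_contra h'
    exact hi (h h')
  rw [this, zero_smul]

theorem supp_smul_subset (b : UnconditionalSchauderBasis ℕ 𝕜 X) (c : 𝕜) (x : X) :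
    supp b (c • x) ⊆ supp b x := by
  intro i hi h
  exact hi (by simp [h])

theorem norm_proj_apply_le [CompleteSpace X] (b : UnconditionalSchauderBasis ℕ 𝕜 X)
    (A : Finset ℕ) (x : X) : ‖b.proj A x‖ ≤ b.nnnormProjBound * ‖x‖ :=
  (b.proj A).le_of_opNorm_le (b.norm_proj_le_nnnormProjBound A) x

/-- Domination for finite sums of blocks. -/
theorem BlockDomination.norm_sum_le {b : UnconditionalSchauderBasis ℕ 𝕜 X} {C : ℝ} {j : ℕ → ℕ}
    (hdom : BlockDomination b C j) {k : ℕ → ℕ} (hk : StrictMono k) (hjk : ∀ n, j n ≤ k n)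
    {f g : ℕ → X} (A : Finset ℕ) (hfg : ∀ n ∈ A, ‖f n‖ ≤ ‖g n‖)
    (hf : ∀ n ∈ A, supp b (f n) ⊆ Set.Ico (k n) (k (n + 1)))
    (hg : ∀ n ∈ A, supp b (g n) ⊆ Set.Ico (k n) (k (n + 1))) :
    ‖∑ n ∈ A, f n‖ ≤ |C| * ‖∑ n ∈ A, g n‖ := by
  -- Blocks outside A are replaced by 0, which has empty support, so the hypothesis on infinite
  -- series applies.
  have hsum : ∀ h : ℕ → X, HasSum (fun n => if n ∈ A then h n else 0) (∑ n ∈ A, h n) := by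
    intro h
    have := hasSum_sum_of_ne_finset_zero (f := fun n => if n ∈ A then h n else 0) (s := A)
      (fun n hn => if_neg hn) (L := SummationFilter.unconditional ℕ)
    rwa [Finset.sum_ite_mem, Finset.inter_self] at this
  refine (hdom k _ _ _ _ hk hjk ?_ ?_ (hsum f) (hsum g)).trans
    (mul_le_mul_of_nonneg_right (le_abs_self C) (norm_nonneg _))
  · intro n
    by_cases h : n ∈ A
    · simpa [h] using hfg n h
    · simp [h]
  · intro n
    by_cases h : n ∈ A
    · simpa only [h, if_true] using Set.union_subset (hf n h) (hg n h)
    · simp [h, supp]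

theorem sum_proj_eq_sum_biUnion (b : UnconditionalSchauderBasis ℕ 𝕜 X) {k : ℕ → ℕ}
    (hk : StrictMono k) {B : ℕ → Finset ℕ}
    (hB : ∀ n, (B n : Set ℕ) ⊆ Set.Ico (k n) (k (n + 1))) (A : Finset ℕ) (x : X) :
    ∑ n ∈ A, b.proj (B n) x = b.proj (A.biUnion B) x := by
  simp only [GeneralSchauderBasis.proj_apply]
  refine (Finset.sum_biUnion ?_).symm
  intro m _ n _ hmn
  refine Finset.disjoint_left.2 fun i hi hi' => hmn ?_
  have h1 := hB m hi
  have h2 := hB n hi'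
  rcases lt_trichotomy m n with h | h | h
  · have := hk.monotone (Nat.succ_le_of_lt h)
    simp only [Set.mem_Ico, Nat.succ_eq_add_one] at *
    omega
  · exact h
  · have := hk.monotone (Nat.succ_le_of_lt h)
    simp only [Set.mem_Ico, Nat.succ_eq_add_one] at *
    omega

/-- Rank-one operators that act on successive blocks and are dominated by coordinate projections
add up to a bounded operator. -/
theorem BlockDomination.exists_operator [CompleteSpace X]
    {b : UnconditionalSchauderBasis ℕ 𝕜 X} {C : ℝ} {j : ℕ → ℕ}
    (hdom : BlockDomination b C j) {k : ℕ → ℕ} (hk : StrictMono k) (hjk : ∀ n, j n ≤ k n)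
    {B : ℕ → Finset ℕ} (hB : ∀ n, (B n : Set ℕ) ⊆ Set.Ico (k n) (k (n + 1)))
    (θ : ℕ → StrongDual 𝕜 X) (w : ℕ → X)
    (hw : ∀ n, supp b (w n) ⊆ Set.Ico (k n) (k (n + 1)))
    (hθ : ∀ n x, ‖θ n x • w n‖ ≤ ‖b.proj (B n) x‖) :
    ∃ T : X →L[𝕜] X, (∀ x, HasSum (fun n => θ n x • w n) (T x)) ∧
      ‖T‖ ≤ |C| * b.nnnormProjBound := by
  have key : ∀ (A : Finset ℕ) x, ‖∑ n ∈ A, θ n x • w n‖ ≤ |C| * ‖b.proj (A.biUnion B) x‖ := by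
    intro A x
    rw [← sum_proj_eq_sum_biUnion b hk hB]
    exact hdom.norm_sum_le hk hjk A (fun n _ => hθ n x)
      (fun n _ => (supp_smul_subset b _ _).trans (hw n))
      (fun n _ => (supp_proj_subset b _ _).trans (hB n))
  have hsum : ∀ x, Summable fun n => θ n x • w n := by
    intro x
    rw [summable_iff_vanishing_norm]
    intro ε hε
    obtain ⟨s, hs⟩ := summable_iff_vanishing_norm.1 (b.expansion x).summable (ε / (|C| + 1))
      (by positivity)
    -- As n ≤ k n, blocks with index past max s lie entirely past s, where the expansion of x has
    -- small sums.
    refine ⟨Finset.range (s.sup id + 1), fun t ht => (key t x).trans_lt ?_⟩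
    have hdisj : Disjoint (t.biUnion B) s := by
      refine Finset.disjoint_left.2 fun i hi his => ?_
      obtain ⟨n, hn, hin⟩ := Finset.mem_biUnion.1 hi
      have h1 : i ≤ s.sup id := Finset.le_sup (f := id) his
      have h2 := (hB n hin).1
      have h3 := hk.id_le n
      have h4 := Finset.disjoint_left.1 ht hn
      simp only [Finset.mem_range, id_eq] at *
      omega
    have h := hs _ hdisj
    rw [← GeneralSchauderBasis.proj_apply] at h
    calc |C| * ‖b.proj (t.biUnion B) x‖ ≤ |C| * (ε / (|C| + 1)) := by gcongr
      _ < ε := by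
        rw [mul_div_assoc', div_lt_iff₀ (by positivity)]
        nlinarith
  let T : X →ₗ[𝕜] X :=
    { toFun := fun x => ∑' n, θ n x • w n
      map_add' := fun x y => by
        rw [← (hsum x).tsum_add (hsum y)]
        simp [add_smul]
      map_smul' := fun c x => by
        rw [RingHom.id_apply, ← (hsum x).tsum_const_smul c]
        simp [mul_smul] }
  have hT : ∀ x, ‖T x‖ ≤ |C| * b.nnnormProjBound * ‖x‖ := by
    intro x
    refine le_of_tendsto (hsum x).hasSum.norm (Eventually.of_forall fun A => (key A x).trans ?_)
    rw [mul_assoc]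
    exact mul_le_mul_of_nonneg_left (norm_proj_apply_le b _ x) (abs_nonneg C)
  exact ⟨T.mkContinuous _ hT, fun x => (hsum x).hasSum,
    T.mkContinuous_norm_le (by positivity) hT⟩

/-- In an infinite-dimensional subspace, normalized vectors with arbitrarily late finite support
can be approximated. -/
theorem exists_block_near (b : UnconditionalSchauderBasis ℕ 𝕜 X) (V : Submodule 𝕜 X)
    (hV : ¬ FiniteDimensional 𝕜 V) (N : ℕ) {ε : ℝ} (hε : 0 < ε) :
    ∃ M u v, N < M ∧ v ∈ V ∧ ‖u‖ = 1 ∧ supp b u ⊆ Set.Ico N M ∧ ‖v - u‖ < ε := by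
  obtain ⟨v, hvV, hv0, hv⟩ : ∃ v ∈ V, v ≠ 0 ∧ ∀ i < N, b.coord i v = 0 := by
    let Φ : V →ₗ[𝕜] (Fin N → 𝕜) :=
      LinearMap.pi fun i => (b.coord i).toLinearMap.comp V.subtype
    -- Finitely many coordinates cannot separate the points of V.
    have hΦ : ¬ Function.Injective Φ := fun h => hV (FiniteDimensional.of_injective Φ h)
    rw [← LinearMap.ker_eq_bot, ← ne_eq, Submodule.ne_bot_iff] at hΦ
    obtain ⟨v, hv, hv0⟩ := hΦ
    refine ⟨v, v.2, by simpa using hv0, fun i hi => ?_⟩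
    exact congrFun (LinearMap.mem_ker.1 hv) ⟨i, hi⟩
  have hlim : Tendsto (fun M => b.proj (Finset.range M) v) atTop (𝓝 v) :=
    (b.expansion v).tendsto_sum_nat.congr fun M => (b.proj_apply _ v).symm
  have h1 : Tendsto (fun M => ‖v - b.proj (Finset.range M) v‖) atTop (𝓝 0) := by
    simpa using (tendsto_const_nhds (x := v)).sub hlim |>.norm
  -- An error relative to the truncation survives normalization, and forces the truncation to be
  -- nonzero.
  have h2 : ∀ᶠ M in atTop, ‖v - b.proj (Finset.range M) v‖ < ε * ‖b.proj (Finset.range M) v‖ :=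
    h1.eventually_lt (hlim.norm.const_mul ε) (by positivity)
  obtain ⟨M, hM, hNM⟩ := (h2.and (eventually_gt_atTop N)).exists
  set p := b.proj (Finset.range M) v with hp
  have hp0 : 0 < ‖p‖ := by
    have := (norm_nonneg _).trans_lt hM
    exact pos_of_mul_pos_right this hε.le
  refine ⟨M, (‖p‖⁻¹ : 𝕜) • p, (‖p‖⁻¹ : 𝕜) • v, hNM, V.smul_mem _ hvV, ?_, ?_, ?_⟩
  · simp [norm_smul, hp0.ne']
  · refine (supp_smul_subset b _ _).trans fun i hi => ?_
    have hiM : i ∈ Finset.range M := by exact_mod_cast supp_proj_subset b _ _ hi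
    refine ⟨?_, by simpa using hiM⟩
    by_contra hlt
    apply hi
    rw [hp, coord_proj, if_pos hiM, hv i (not_le.1 hlt)]
  · rw [← smul_sub, norm_smul]
    simp only [norm_inv, RCLike.norm_ofReal, abs_norm]
    rwa [inv_mul_lt_iff₀ hp0, mul_comm]

/-- Gliding hump: an infinite-dimensional subspace contains small perturbations of a normalized
block sequence whose blocks start beyond `j`. -/
theorem exists_block_sequence_near (b : UnconditionalSchauderBasis ℕ 𝕜 X) (V : Submodule 𝕜 X)
    (hV : ¬ FiniteDimensional 𝕜 V) (j : ℕ → ℕ) {ε : ℕ → ℝ} (hε : ∀ n, 0 < ε n) :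
    ∃ (k : ℕ → ℕ) (u v : ℕ → X), StrictMono k ∧ (∀ n, j n ≤ k n) ∧ (∀ n, v n ∈ V) ∧
      (∀ n, ‖u n‖ = 1) ∧ (∀ n, supp b (u n) ⊆ Set.Ico (k n) (k (n + 1))) ∧
      ∀ n, ‖v n - u n‖ < ε n := by
  choose M u v hNM hv hu hsupp huv using
    fun (n N : ℕ) => exists_block_near b V hV N (hε n)
  -- The next block starts after the current one ends and no earlier than j (n + 1).
  let k : ℕ → ℕ := fun n => Nat.rec (j 0) (fun n N => max (M n N) (j (n + 1))) n
  have hk : ∀ n, k (n + 1) = max (M n (k n)) (j (n + 1)) := fun n => rfl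
  refine ⟨k, fun n => u n (k n), fun n => v n (k n), strictMono_nat_of_lt_succ fun n => ?_, ?_,
    fun n => hv _ _, fun n => hu _ _, fun n => (hsupp _ _).trans ?_, fun n => huv _ _⟩
  · rw [hk]
    exact (hNM n (k n)).trans_le (le_max_left _ _)
  · rintro (_ | n)
    · exact le_rfl
    · rw [hk]
      exact le_max_right _ _
  · rw [hk]
    exact Set.Ico_subset_Ico_right (le_max_left _ _)

theorem hasSum_mem_closedSpan {v : ℕ → X} {c : ℕ → 𝕜} {x : X}
    (h : HasSum (fun n => c n • v n) x) : x ∈ closedSpan (𝕜 := 𝕜) v := by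
  refine mem_closure_of_tendsto h (Eventually.of_forall fun A => ?_)
  exact Submodule.sum_mem _ fun n _ => Submodule.smul_mem _ _ (Submodule.subset_span ⟨n, rfl⟩)

theorem isClosed_closedSpan (v : ℕ → X) : IsClosed (closedSpan (𝕜 := 𝕜) v : Set X) :=
  Submodule.isClosed_topologicalClosure _

theorem mem_closedSpan (v : ℕ → X) (n : ℕ) : v n ∈ closedSpan (𝕜 := 𝕜) v :=
  Submodule.le_topologicalClosure _ (Submodule.subset_span ⟨n, rfl⟩)

theorem not_finiteDimensional_closedSpan {v : ℕ → X} (hv : LinearIndependent 𝕜 v) :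
    ¬ FiniteDimensional 𝕜 (closedSpan (𝕜 := 𝕜) v) := by
  intro hfin
  have h : LinearIndependent 𝕜 fun n => (⟨v n, mem_closedSpan v n⟩ : closedSpan (𝕜 := 𝕜) v) :=
    LinearIndependent.of_comp (closedSpan (𝕜 := 𝕜) v).subtype hv
  exact not_finite_iff_infinite.2 (inferInstanceAs (Infinite ℕ)) h.finite

end Basis

/-! ### Subprojectivity of the space -/

section Subprojective

variable {𝕜 : Type*} [RCLike 𝕜]
variable {X : Type*} [NormedAddCommGroup X] [NormedSpace 𝕜 X]

theorem basis_ne_zero (b : UnconditionalSchauderBasis ℕ 𝕜 X) (i : ℕ) : b i ≠ 0 :=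
  b.linearIndependent.ne_zero i

theorem coord_basis_of_ne (b : UnconditionalSchauderBasis ℕ 𝕜 X) {i m : ℕ} (h : i ≠ m) :
    b.coord i (b m) = 0 := by
  simp [b.ortho, h]

theorem supp_basis_subset (b : UnconditionalSchauderBasis ℕ 𝕜 X) (i : ℕ) :
    supp b (b i) ⊆ {i} := by
  intro m hm
  by_contra h
  exact hm (coord_basis_of_ne b h)

theorem map_mem_of_mem_closedSpan {E : Type*} [NormedAddCommGroup E] [NormedSpace 𝕜 E]
    (S : X →L[𝕜] E) {v : ℕ → X} {V : Submodule 𝕜 E} (hV : IsClosed (V : Set E))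
    (h : ∀ n, S (v n) ∈ V) {x : X} (hx : x ∈ closedSpan (𝕜 := 𝕜) v) : S x ∈ V := by
  have hle : closedSpan (𝕜 := 𝕜) v ≤ V.comap S.toLinearMap := by
    refine Submodule.topologicalClosure_minimal _ ?_ (hV.preimage S.continuous)
    rw [Submodule.span_le]
    rintro _ ⟨n, rfl⟩
    exact h n
  exact hle hx

variable [CompleteSpace X]

/-- A normalized block sequence beyond `j` is equivalent to a subsequence of the basis, and its
closed span is complemented: this is witnessed by a pair of operators with bounded norms. -/
theorem BlockDomination.exists_block_operators {b : UnconditionalSchauderBasis ℕ 𝕜 X} {C : ℝ}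
    {j : ℕ → ℕ} (hdom : BlockDomination b C j) {k : ℕ → ℕ} (hk : StrictMono k)
    (hjk : ∀ n, j n ≤ k n) {u : ℕ → X} (hu : ∀ n, ‖u n‖ = 1)
    (hsupp : ∀ n, supp b (u n) ⊆ Set.Ico (k n) (k (n + 1))) :
    ∃ (S R : X →L[𝕜] X),
      (∀ n, S (b (k n)) = (‖b (k n)‖ : 𝕜) • u n) ∧
      (∀ n, R (u n) = (‖b (k n)‖⁻¹ : 𝕜) • b (k n)) ∧
      (∀ x, R x ∈ closedSpan (𝕜 := 𝕜) fun n => b (k n)) ∧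
      ‖R‖ ≤ |C| * b.nnnormProjBound := by
  have hnorm : ∀ n, ‖b (k n)‖ ≠ 0 := fun n => norm_ne_zero_iff.2 (basis_ne_zero b _)
  have hu0 : ∀ n, ‖u n‖ ≠ 0 := fun n => by simp [hu n]
  choose φ hφ hφu using fun n => exists_dual_vector 𝕜 (u n) (hu0 n)
  let B : ℕ → Finset ℕ := fun n => Finset.Ico (k n) (k (n + 1))
  have hB : ∀ n, (B n : Set ℕ) ⊆ Set.Ico (k n) (k (n + 1)) := fun n => by simp [B]
  have hproj : ∀ n, b.proj (B n) (u n) = u n := fun n =>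
    proj_eq_self_of_supp_subset b (by simpa [B] using hsupp n)
  have hproj' : ∀ m n, m ≠ n → b.proj (B m) (u n) = 0 := by
    intro m n hmn
    have h := sum_proj_eq_sum_biUnion b hk hB {m, n} (u n)
    rw [Finset.sum_pair hmn, hproj, proj_eq_self_of_supp_subset b (A := Finset.biUnion {m, n} B)] at h
    · exact add_eq_right.1 h
    · refine (hsupp n).trans ?_
      simp [B]
  -- The n-th summand of S x has exactly the norm of the projection of x onto coordinate k n.
  obtain ⟨S, hS, -⟩ := hdom.exists_operator hk hjk (B := fun n => {k n})
    (fun n => by simpa using hk n.lt_succ_self)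
    (fun n => (‖b (k n)‖ : 𝕜) • b.coord (k n)) u hsupp (fun n x => by
      simp [norm_smul, hu, mul_comm])
  -- The n-th summand of R x has norm |φ n (P x)| ≤ ‖P x‖, with P the projection onto the n-th
  -- block.
  obtain ⟨R, hR, hRnorm⟩ := hdom.exists_operator hk hjk hB
    (fun n => (φ n).comp (b.proj (B n))) (fun n => (‖b (k n)‖⁻¹ : 𝕜) • b (k n))
    (fun n => (supp_smul_subset b _ _).trans
      ((supp_basis_subset b _).trans (by simpa using hk n.lt_succ_self)))
    (fun n x => by
      have h := (φ n).le_opNorm (b.proj (B n) x)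
      rw [hφ, one_mul] at h
      rw [ContinuousLinearMap.comp_apply, norm_smul, norm_smul]
      simpa only [norm_inv, RCLike.norm_ofReal, abs_norm, inv_mul_cancel₀ (hnorm n), mul_one])
  refine ⟨S, R, fun n => ?_, fun n => ?_, fun x => ?_, hRnorm⟩
  · refine (hS (b (k n))).unique ?_
    convert hasSum_single n fun m hm => ?_ using 1
    · simp [b.ortho]
    · simp [coord_basis_of_ne b (hk.injective.ne hm)]
  · refine (hR (u n)).unique ?_
    convert hasSum_single n fun m hm => ?_ using 1
    · rw [ContinuousLinearMap.comp_apply, hproj, hφu, hu]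
      simp
    · rw [ContinuousLinearMap.comp_apply, hproj' m n hm]
      simp
  · have h := hR x
    simp only [smul_smul] at h
    exact hasSum_mem_closedSpan h

/-- The perturbation part: an operator of small norm that moves each `b (k n)` by
`‖b (k n)‖ • d n`. -/
theorem exists_perturbation (b : UnconditionalSchauderBasis ℕ 𝕜 X) {k : ℕ → ℕ} (hk : StrictMono k)
    {d : ℕ → X} {δ : ℝ} (hd : ∀ n, ‖d n‖ ≤ δ * (1 / 2) ^ n) :
    ∃ D : X →L[𝕜] X, (∀ n, D (b (k n)) = (‖b (k n)‖ : 𝕜) • d n) ∧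
      ‖D‖ ≤ b.nnnormProjBound * (δ * 2) := by
  let θ : ℕ → StrongDual 𝕜 X := fun n => (‖b (k n)‖ : 𝕜) • b.coord (k n)
  have hθ : ∀ n, ‖θ n‖ ≤ b.nnnormProjBound := by
    intro n
    refine ContinuousLinearMap.opNorm_le_bound _ (NNReal.coe_nonneg _) fun x => ?_
    have h := norm_proj_apply_le b {k n} x
    simpa [θ, norm_smul, mul_comm] using h
  have hbound : ∀ n, ‖(θ n).smulRight (d n)‖ ≤ b.nnnormProjBound * (δ * (1 / 2) ^ n) := by
    intro n
    rw [ContinuousLinearMap.norm_smulRight_apply]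
    exact mul_le_mul (hθ n) (hd n) (norm_nonneg _) (NNReal.coe_nonneg _)
  have hgeo : HasSum (fun n => (b.nnnormProjBound : ℝ) * (δ * (1 / 2) ^ n))
      (b.nnnormProjBound * (δ * 2)) := (hasSum_geometric_two.mul_left δ).mul_left _
  have hsum : Summable fun n => (θ n).smulRight (d n) :=
    Summable.of_norm_bounded hgeo.summable hbound
  refine ⟨∑' n, (θ n).smulRight (d n), fun n => ?_, tsum_of_norm_bounded hgeo hbound⟩
  have h := (ContinuousLinearMap.apply 𝕜 X (b (k n))).hasSum hsum.hasSum
  refine h.unique ?_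
  convert hasSum_single n fun m hm => ?_ using 1
  · simp [θ, b.ortho]
  · simp [θ, coord_basis_of_ne b (hk.injective.ne hm)]

/-- Perturbation of S by D, which carries the gliding-hump errors v n - u n: S + D sends b (k n) to
a multiple of v n, hence W into V. -/
theorem BlockDomination.isSubprojectiveFor {b : UnconditionalSchauderBasis ℕ 𝕜 X} {C : ℝ}
    {j : ℕ → ℕ} (hdom : BlockDomination b C j) :
    IsSubprojectiveFor 𝕜 X (subbasisSpans 𝕜 b.basis j) := by
  intro V hVc hV
  set K : ℝ := (b.nnnormProjBound : ℝ)
  have hK : 0 ≤ K := NNReal.coe_nonneg _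
  -- Chosen so that ‖R‖ ‖D‖ ≤ (|C| K)(2 K δ) < 1.
  set δ : ℝ := (2 * (|C| * K * K + 1))⁻¹ with hδ
  have hδ0 : 0 < δ := by positivity
  obtain ⟨k, u, v, hk, hjk, hv, hu, hsupp, huv⟩ :=
    exists_block_sequence_near b V hV j (ε := fun n => δ * (1 / 2) ^ n) (fun n => by positivity)
  obtain ⟨S, R, hS, hR, hRW, hRnorm⟩ := hdom.exists_block_operators hk hjk hu hsupp
  obtain ⟨D, hD, hDnorm⟩ := exists_perturbation b hk (d := fun n => v n - u n)
    (fun n => (huv n).le)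
  let W := closedSpan (𝕜 := 𝕜) fun n => b (k n)
  have hWc : IsClosed (W : Set X) := isClosed_closedSpan _
  have : CompleteSpace W := hWc.completeSpace_coe
  have hW : ¬ FiniteDimensional 𝕜 W :=
    not_finiteDimensional_closedSpan (b.linearIndependent.comp k hk.injective)
  have hnorm : ∀ n, (‖b (k n)‖ : 𝕜) ≠ 0 := fun n => by
    simpa using basis_ne_zero b (k n)
  have hRS : ∀ w ∈ W, (R.comp S - ContinuousLinearMap.id 𝕜 X) w ∈ (⊥ : Submodule 𝕜 X) := by
    intro w hw
    refine map_mem_of_mem_closedSpan _ isClosed_singleton (fun n => ?_) hw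
    simp [hS, hR, smul_smul, hnorm]
  let R' : X →L[𝕜] W := R.codRestrict W hRW
  have hR'norm : ‖R'‖ ≤ |C| * K :=
    ContinuousLinearMap.opNorm_le_bound _ (by positivity) fun x => R.le_of_opNorm_le hRnorm x
  have hVmem : ∀ w : W, ((S + D).comp W.subtypeL) w ∈ V := fun w =>
    map_mem_of_mem_closedSpan (S + D) hVc (fun n => by
      rw [_root_.add_apply, hS, hD, ← smul_add, add_sub_cancel]
      exact V.smul_mem _ (hv n)) w.2
  have hdiff : ‖S.comp W.subtypeL - (S + D).comp W.subtypeL‖ ≤ K * (δ * 2) := by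
    refine ContinuousLinearMap.opNorm_le_bound _ (by positivity) fun w => ?_
    simpa using D.le_of_opNorm_le hDnorm w
  have hsmall : ‖R'.comp (S.comp W.subtypeL - (S + D).comp W.subtypeL)‖ < 1 :=
    calc ‖R'.comp (S.comp W.subtypeL - (S + D).comp W.subtypeL)‖
        ≤ ‖R'‖ * ‖S.comp W.subtypeL - (S + D).comp W.subtypeL‖ :=
          ContinuousLinearMap.opNorm_comp_le _ _
      _ ≤ (|C| * K) * (K * (δ * 2)) := by gcongr
      _ = (|C| * K * K) / (|C| * K * K + 1) := by
          rw [hδ]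
          field_simp
      _ < 1 := by
          rw [div_lt_one (by positivity)]
          linarith
  obtain ⟨U, hUV, hUfin, hUc, hUW⟩ := exists_complemented_copy hW (S.comp W.subtypeL)
    ((S + D).comp W.subtypeL) R'
    (fun w => Subtype.ext (by simpa [R', sub_eq_zero] using hRS w w.2)) hsmall V hVmem
  exact ⟨U, hUV, hUfin, hUc, W, ⟨k, hk, hjk, rfl⟩, hUW⟩

end Subprojective

/-! ### The dual basis and duality of domination -/

section Dual

variable {𝕜 : Type*} [RCLike 𝕜]
variable {X : Type*} [NormedAddCommGroup X] [NormedSpace 𝕜 X] [CompleteSpace X]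

/-- Functionals in the closed span of the coordinate functionals are the norm limits of their
partial expansions. -/
theorem hasSum_coord_of_mem_closedSpan (b : UnconditionalSchauderBasis ℕ 𝕜 X)
    {y : StrongDual 𝕜 X} (hy : y ∈ closedSpan (𝕜 := 𝕜) b.coord) :
    HasSum (fun i => y (b i) • b.coord i) y := by
  have hpart : ∀ (A : Finset ℕ) (z : StrongDual 𝕜 X),
      ∑ i ∈ A, z (b i) • b.coord i = z.comp (b.proj A) := by
    intro A z
    ext x
    simp [_root_.sum_apply, mul_comm]
  -- On the span the expansion is eventually exact; the uniform bound on projections carries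
  -- convergence to the closure.
  have hspan : ∀ z ∈ Submodule.span 𝕜 (Set.range b.coord),
      ∀ᶠ A : Finset ℕ in atTop, z.comp (b.proj A) = z := by
    intro z hz
    induction hz using Submodule.span_induction with
    | mem z hz =>
      obtain ⟨i, rfl⟩ := hz
      filter_upwards [eventually_ge_atTop {i}] with A hA
      ext x
      rw [ContinuousLinearMap.comp_apply, coord_proj, if_pos (hA (Finset.mem_singleton_self i))]
    | zero => simp
    | add z w _ _ hz hw =>
      filter_upwards [hz, hw] with A h1 h2
      rw [ContinuousLinearMap.add_comp, h1, h2]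
    | smul c z _ hz =>
      filter_upwards [hz] with A h1
      rw [ContinuousLinearMap.smul_comp, h1]
  set K : ℝ := (b.nnnormProjBound : ℝ)
  have hK : 0 ≤ K := NNReal.coe_nonneg _
  rw [HasSum, SummationFilter.unconditional_filter, Metric.tendsto_nhds]
  intro ε hε
  obtain ⟨z, hz, hyz⟩ := Metric.mem_closure_iff.1 hy (ε / (K + 1)) (by positivity)
  filter_upwards [hspan z hz] with A hA
  rw [hpart, dist_eq_norm]
  have h : y.comp (b.proj A) - y = (y - z).comp (b.proj A) - (y - z) := by
    rw [ContinuousLinearMap.sub_comp, hA]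
    abel
  rw [dist_eq_norm] at hyz
  calc ‖y.comp (b.proj A) - y‖ ≤ ‖(y - z).comp (b.proj A)‖ + ‖y - z‖ := by
        rw [h]
        exact norm_sub_le _ _
    _ ≤ ‖y - z‖ * K + ‖y - z‖ := by
        gcongr
        refine (ContinuousLinearMap.opNorm_comp_le _ _).trans ?_
        gcongr
        exact b.norm_proj_le_nnnormProjBound A
    _ = ‖y - z‖ * (K + 1) := by ring
    _ < ε := by rwa [← lt_div_iff₀ (by positivity)]

/-- The coordinate functionals as an unconditional basis of their closed linear span. -/
noncomputable def dualBasis (b : UnconditionalSchauderBasis ℕ 𝕜 X) :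
    UnconditionalSchauderBasis ℕ 𝕜 (closedSpan (𝕜 := 𝕜) b.coord) where
  basis i := ⟨b.coord i, mem_closedSpan b.coord i⟩
  coord i := (ContinuousLinearMap.apply 𝕜 𝕜 (b i)).comp (Submodule.subtypeL _)
  ortho i m := by
    simp [b.ortho, Pi.single_apply, eq_comm]
  expansion y := by
    have h := hasSum_coord_of_mem_closedSpan b y.2
    rw [← Topology.IsInducing.subtypeVal.hasSum_iff (g := Submodule.subtype _)]
    exact h

theorem apply_proj_of_supp_subset (b : UnconditionalSchauderBasis ℕ 𝕜 X)
    {y : closedSpan (𝕜 := 𝕜) b.coord} {A : Finset ℕ} (h : supp (dualBasis b) y ⊆ A) (x : X) :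
    y.1 (b.proj A x) = y.1 x := by
  conv_rhs => rw [← proj_eq_self_of_supp_subset (dualBasis b) h]
  simp [dualBasis, _root_.sum_apply, mul_comm]

theorem apply_proj_of_supp_disjoint (b : UnconditionalSchauderBasis ℕ 𝕜 X)
    {y : closedSpan (𝕜 := 𝕜) b.coord} {A : Finset ℕ} (h : Disjoint (supp (dualBasis b) y) A)
    (x : X) : y.1 (b.proj A x) = 0 := by
  rw [GeneralSchauderBasis.proj_apply, map_sum]
  refine Finset.sum_eq_zero fun i hi => ?_
  have : y.1 (b i) = 0 := by
    by_contra h'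
    exact Set.disjoint_left.1 h h' hi
  rw [map_smul, this, smul_zero]

/-- A functional almost attains its norm at a vector of prescribed norm, up to a factor `2`. -/
theorem exists_norm_le_mul_norm_le_apply {E : Type*} [NormedAddCommGroup E] [NormedSpace 𝕜 E]
    (y : StrongDual 𝕜 E) {r : ℝ} (hr : 0 ≤ r) :
    ∃ z : E, ‖z‖ ≤ r ∧ ∃ t : ℝ, y z = t ∧ ‖y‖ * r ≤ 2 * t := by
  rcases eq_or_ne y 0 with rfl | hy
  · exact ⟨0, by simpa using hr, 0, by simp⟩
  have hy0 : 0 < ‖y‖ := norm_pos_iff.2 hy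
  obtain ⟨x, hx, hyx⟩ := y.exists_lt_apply_of_lt_opNorm (half_lt_self hy0)
  have hyx0 : ‖y x‖ ≠ 0 := (by positivity : (0 : ℝ) < ‖y‖ / 2).trans hyx |>.ne'
  -- The conjugate phase of y x makes the value real and nonnegative.
  refine ⟨((r : 𝕜) * (starRingEnd 𝕜 (y x) * (‖y x‖ : 𝕜)⁻¹)) • x, ?_, r * ‖y x‖, ?_, ?_⟩
  · rw [norm_smul, norm_mul, norm_mul, norm_inv, RCLike.norm_conj, RCLike.norm_ofReal,
      RCLike.norm_ofReal, abs_norm, mul_inv_cancel₀ hyx0, mul_one, abs_of_nonneg hr]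
    exact mul_le_of_le_one_right hr hx.le
  · have h0 : (‖y x‖ : 𝕜) ≠ 0 := by exact_mod_cast hyx0
    rw [map_smul, smul_eq_mul, mul_assoc, mul_right_comm, RCLike.conj_mul]
    push_cast
    field_simp
  · nlinarith

/-- Block domination passes to the dual basis. -/
theorem BlockDomination.dualBasis {b : UnconditionalSchauderBasis ℕ 𝕜 X} {C : ℝ} {j : ℕ → ℕ}
    (hdom : BlockDomination b C j) :
    BlockDomination (dualBasis b) (2 * b.nnnormProjBound * (|C| * b.nnnormProjBound)) j := by
  intro k f g F G hk hjk hfg hsupp hF hG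
  set K : ℝ := (b.nnnormProjBound : ℝ)
  have hK : 0 ≤ K := NNReal.coe_nonneg _
  let B : ℕ → Finset ℕ := fun n => Finset.Ico (k n) (k (n + 1))
  have hB : ∀ n, (B n : Set ℕ) ⊆ Set.Ico (k n) (k (n + 1)) := fun n => by simp [B]
  have hsf : ∀ n, supp (UncondBasis.dualBasis b) (f n) ⊆ B n := fun n =>
    Set.subset_union_left.trans (by simpa [B] using hsupp n)
  have hsg : ∀ n, supp (UncondBasis.dualBasis b) (g n) ⊆ B n := fun n =>
    Set.subset_union_right.trans (by simpa [B] using hsupp n)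
  have happ : ∀ {h : ℕ → closedSpan (𝕜 := 𝕜) b.coord} {H}, HasSum h H → ∀ x,
      HasSum (fun n => (h n).1 x) (H.1 x) := fun hH x =>
    ((ContinuousLinearMap.apply 𝕜 𝕜 x).comp (Submodule.subtypeL _)).hasSum hH
  have hGB : ∀ n x, G.1 (b.proj (B n) x) = (g n).1 x := by
    intro n x
    rw [← apply_proj_of_supp_subset b (hsg n)]
    refine (happ hG _).unique (hasSum_single n fun m hm => ?_)
    refine apply_proj_of_supp_disjoint b (Set.disjoint_of_subset_left (hsg m) ?_) x
    simp only [B, Finset.coe_Ico]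
    exact hk.monotone.pairwise_disjoint_on_Ico_succ hm
  refine ContinuousLinearMap.opNorm_le_bound F.1 (by positivity) fun x => ?_
  refine le_of_tendsto (happ hF x).norm (Eventually.of_forall fun A => ?_)
  choose z hz t ht hzt using fun n =>
    exists_norm_le_mul_norm_le_apply (g n).1 (norm_nonneg (b.proj (B n) x))
  -- The z n need not live on their blocks; projecting them costs a factor K, absorbed by scaling
  -- the dominating blocks by K.
  have hbound : ‖∑ n ∈ A, b.proj (B n) (z n)‖ ≤ K * (|C| * (K * ‖x‖)) := by
    have h := hdom.norm_sum_le hk hjk (f := fun n => b.proj (B n) (z n))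
      (g := fun n => (K : 𝕜) • b.proj (B n) x) A (fun n _ => ?_)
      (fun n _ => (supp_proj_subset b _ _).trans (hB n))
      (fun n _ => (supp_smul_subset b _ _).trans ((supp_proj_subset b _ _).trans (hB n)))
    · rw [← Finset.smul_sum, norm_smul, RCLike.norm_ofReal, abs_of_nonneg hK,
        sum_proj_eq_sum_biUnion b hk hB] at h
      refine h.trans ?_
      rw [mul_left_comm]
      gcongr
      exact norm_proj_apply_le b _ x
    · rw [norm_smul, RCLike.norm_ofReal, abs_of_nonneg hK]
      exact (norm_proj_apply_le b _ _).trans (mul_le_mul_of_nonneg_left (hz n) hK)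
  have hsum : ((∑ n ∈ A, t n : ℝ) : 𝕜) = G.1 (∑ n ∈ A, b.proj (B n) (z n)) := by
    rw [map_sum]
    push_cast
    exact Finset.sum_congr rfl fun n _ => by rw [hGB, ht]
  -- Each |f n (x)| is at most ‖g n‖ ‖P x‖ ≤ 2 t n, with P the n-th block projection, and the t n
  -- add up to one value of G.
  calc ‖∑ n ∈ A, (f n).1 x‖ ≤ ∑ n ∈ A, ‖(f n).1 x‖ := _root_.norm_sum_le _ _
    _ ≤ ∑ n ∈ A, 2 * t n := by
        refine Finset.sum_le_sum fun n _ => ?_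
        rw [← apply_proj_of_supp_subset b (hsf n)]
        refine ((f n).1.le_opNorm _).trans (le_trans ?_ (hzt n))
        exact mul_le_mul_of_nonneg_right (hfg n) (norm_nonneg _)
    _ = 2 * ∑ n ∈ A, t n := (Finset.mul_sum _ _ _).symm
    _ ≤ 2 * ‖G.1 (∑ n ∈ A, b.proj (B n) (z n))‖ := by
        rw [← hsum, RCLike.norm_ofReal]
        gcongr
        exact le_abs_self _
    _ ≤ 2 * (‖G‖ * (K * (|C| * (K * ‖x‖)))) := by
        gcongr
        exact G.1.le_of_opNorm_le_of_le le_rfl hbound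
    _ = 2 * K * (|C| * K) * ‖G‖ * ‖x‖ := by ring

/-- The closed span of a sequence in a closed subspace is the same computed in either space. -/
theorem nonempty_closedSpan_equiv {E : Type*} [NormedAddCommGroup E] [NormedSpace 𝕜 E]
    {Y : Submodule 𝕜 E} (hY : IsClosed (Y : Set E)) (v : ℕ → Y) :
    Nonempty (closedSpan (𝕜 := 𝕜) v ≃L[𝕜] closedSpan (𝕜 := 𝕜) fun n => (v n : E)) := by
  have hmap : closedSpan (𝕜 := 𝕜) (fun n => (v n : E)) =
      (closedSpan (𝕜 := 𝕜) v).map Y.subtypeₗᵢ.toLinearMap := by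
    apply SetLike.coe_injective
    have h := hY.isClosedEmbedding_subtypeVal.closure_image_eq
      (Submodule.span 𝕜 (Set.range v) : Set Y)
    have h2 : (Submodule.span 𝕜 (Set.range fun n => (v n : E)) : Set E) =
        (fun y : Y => (y : E)) '' (Submodule.span 𝕜 (Set.range v) : Set Y) := by
      have := Submodule.map_span Y.subtype (Set.range v)
      rw [← Set.range_comp] at this
      exact (congrArg (fun p : Submodule 𝕜 E => (p : Set E)) this).symm
    rw [closedSpan, Submodule.topologicalClosure_coe, h2]
    exact h
  rw [hmap]
  refine ⟨(LinearIsometryEquiv.ofSurjective (Y.subtypeₗᵢ.submoduleMap _)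
    ?_).toContinuousLinearEquiv⟩
  rintro ⟨_, y, hy, rfl⟩
  exact ⟨⟨y, hy⟩, rfl⟩

end Dual

end UncondBasis

theorem theorem3p11 {𝕜 : Type*} [RCLike 𝕜]
    {X : Type*} [NormedAddCommGroup X] [NormedSpace 𝕜 X] [CompleteSpace X]
    (b : UnconditionalSchauderBasis ℕ 𝕜 X) (C : ℝ) (j : ℕ → ℕ) (hj : Monotone j)
    (hdom : UncondBasis.BlockDomination b C j) :
    UncondBasis.IsSubprojectiveFor 𝕜 X (UncondBasis.subbasisSpans 𝕜 b.basis j) ∧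
    UncondBasis.IsSubprojectiveFor 𝕜 (UncondBasis.closedSpan (𝕜 := 𝕜) b.coord)
      (UncondBasis.subbasisSpans 𝕜 b.coord j) := by
  refine ⟨hdom.isSubprojectiveFor, fun V hVc hV => ?_⟩
  have hYc := UncondBasis.isClosed_closedSpan (𝕜 := 𝕜) b.coord
  have : CompleteSpace (UncondBasis.closedSpan (𝕜 := 𝕜) b.coord) := hYc.completeSpace_coe
  obtain ⟨U, hUV, hUfin, hUc, _, ⟨k, hk, hjk, rfl⟩, ⟨e⟩⟩ :=
    hdom.dualBasis.isSubprojectiveFor V hVc hV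
  -- The spans obtained lie in the closed span of the functionals; those required lie in the full
  -- dual.
  obtain ⟨e'⟩ := UncondBasis.nonempty_closedSpan_equiv hYc
    fun n => (UncondBasis.dualBasis b).basis (k n)
  exact ⟨U, hUV, hUfin, hUc, _, ⟨k, hk, hjk, rfl⟩, ⟨e.trans e'⟩⟩
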